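/- Consider a memory game with $2n$ cards bearing $n$ different labels, two cards for each label. The cards lie face down in a row, and their order is a permutation of the multiset $\{1,1,2,2,\dots,n,n\}$ chosen uniformly at random. At each move a player with perfect memory flips over two cards; if they match they are removed, otherwise they are turned face down again. She plays as follows. If before a move she knows the places of two matching cards that have not been removed, she flips and removes this pair. Otherwise she flips the leftmost card that has never been flipped; if its matching card has been flipped before, she flips that card again and removes the pair; if not, she flips the next card (from left to right) that has never been flipped. A move is called lucky if the two cards flipped in it are next to each other in the row, match, and neither of them was flipped before this move. Let $L_n$ be the number of lucky moves in the game. Then, as $n\to\infty$, $L_n$ converges in distribution to a Poisson random variable with parameter $\ln 2$: \[ L_n \xrightarrow{d} \mathrm{Pois}(\ln 2). \] -/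

import Mathlib

open MeasureTheory ProbabilityTheory Filter

/-- A deal of `n` pairs of cards in a row of `2n` positions: a labelling of the positions by
`n` labels that uses each label exactly twice, i.e. a permutation of `{1,1,2,2,…,n,n}`. -/
def Deal (n : ℕ) : Type :=
  {d : Fin (2 * n) → Fin n // ∀ i, (Finset.univ.filter fun j => d j = i).card = 2}

instance (n : ℕ) : Fintype (Deal n) :=
  inferInstanceAs (Fintype {d : Fin (2 * n) → Fin n //
    ∀ i, (Finset.univ.filter fun j => d j = i).card = 2})

instance (n : ℕ) : MeasurableSpace (Deal n) := ⊤

instance (n : ℕ) : Nonempty (Deal n) := by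
  refine ⟨⟨fun j => ⟨j.val / 2, by omega⟩, fun i => ?_⟩⟩
  have h : (Finset.univ.filter fun j : Fin (2 * n) => (⟨j.val / 2, by omega⟩ : Fin n) = i)
      = {⟨2 * i.val, by omega⟩, ⟨2 * i.val + 1, by omega⟩} := by
    ext j
    simp only [Finset.mem_filter, Finset.mem_univ, true_and, Finset.mem_insert,
      Finset.mem_singleton, Fin.ext_iff]
    omega
  rw [h, Finset.card_pair]
  simp [Fin.ext_iff]

/-- The moves of the player from the moment when the positions in `seen` have been flipped at
least once, those in the second list (from left to right) have never been flipped, and no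
unremoved matching pair is known. A move is the pair of positions flipped, in order.

She flips the first unflipped card `a`. If its mate `q` was seen, she flips `q` and removes the
pair. Otherwise she flips the next unflipped card `b`; if `b` does not match `a` but its mate `q`
was seen before, then her next move is to remove the pair `b`, `q`.

In a deal, a single unflipped card always has its mate in `seen`, so the value `[]` for a single
unflipped card without a seen mate is never used. -/
def play {n : ℕ} (d : Fin (2 * n) → Fin n) :
    List (Fin (2 * n)) → List (Fin (2 * n)) → List (Fin (2 * n) × Fin (2 * n))
  | _, [] => []
  | seen, [a] =>
    match seen.find? (fun q => d q = d a) with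
    | some q => [(a, q)]
    | none => []
  | seen, a :: b :: rest =>
    match seen.find? (fun q => d q = d a) with
    | some q => (a, q) :: play d (a :: seen) (b :: rest)
    | none =>
      if d a = d b then (a, b) :: play d (b :: a :: seen) rest
      else
        match seen.find? (fun q => d q = d b) with
        | some q => (a, b) :: (b, q) :: play d (b :: a :: seen) rest
        | none => (a, b) :: play d (b :: a :: seen) rest

/-- The sequence of moves of the whole game on the deal `d`. -/
def Deal.moves {n : ℕ} (d : Deal n) : List (Fin (2 * n) × Fin (2 * n)) :=
  play d.1 [] (List.finRange (2 * n))

/-- The `t`-th move of the game is lucky: its two cards are next to each other, they match, and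
neither of them was flipped in an earlier move. -/
def Deal.IsLucky {n : ℕ} (d : Deal n) (t : Fin d.moves.length) : Prop :=
  (d.moves.get t).1.val + 1 = (d.moves.get t).2.val ∧
  d.1 (d.moves.get t).1 = d.1 (d.moves.get t).2 ∧
  ∀ s < t, ∀ c ∈ [(d.moves.get s).1, (d.moves.get s).2],
    c ≠ (d.moves.get t).1 ∧ c ≠ (d.moves.get t).2

instance {n : ℕ} (d : Deal n) : DecidablePred d.IsLucky := fun t => by
  unfold Deal.IsLucky; infer_instance

/-- The number of lucky moves of the game on the deal `d`. -/
def Deal.luckyMoves {n : ℕ} (d : Deal n) : ℕ :=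
  (Finset.univ.filter fun t => d.IsLucky t).card

/-- The uniform distribution on the deals of `n` pairs. -/
noncomputable def uniformDeal (n : ℕ) : Measure (Deal n) :=
  (PMF.uniformOfFintype (Deal n)).toMeasure

instance (n : ℕ) : IsProbabilityMeasure (uniformDeal n) :=
  inferInstanceAs (IsProbabilityMeasure (PMF.uniformOfFintype (Deal n)).toMeasure)


/-!
In the state with `k` labels not seen and `u` labels seen once, the unflipped cards are in uniformly
random order, so conditioning on the next one or two of them gives a recursion for the generating
function of the number of lucky moves at `z`. Let `q` be the probability that the next two cards
match. Up to lower order terms a move changes the proportion `y = 2k / (2k + u)` by `-q * (1 + y)`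
on average, while the possibility of a lucky move contributes `q * (z - 1)` times the generating
function. In the limit this becomes `(1 + y) * f' y = (z - 1) * f y` with `f 0 = 1`, so that
`f 1 = 2 ^ (z - 1)`, the generating function of the Poisson distribution with parameter `log 2`.
A second order Taylor expansion bounds the error of one move by a constant times `q / (2k + u)`.
Since `q` does not increase on average over a move, these errors add up to at most a constant times
`q` times the harmonic number of `2k + u`, which tends to zero at the initial state as `n → ∞`.
-/

section Game

variable {N : ℕ} {α : Type*}

/-- The `t`-th move of `l` is lucky when the positions in `P` have been flipped before the first
move of `l`. -/
def IsLuckyAfter (d : Fin N → α) (P : Finset (Fin N)) (l : List (Fin N × Fin N))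
    (t : Fin l.length) : Prop :=
  (l.get t).1.val + 1 = (l.get t).2.val ∧ d (l.get t).1 = d (l.get t).2 ∧
    ((l.get t).1 ∉ P ∧ (l.get t).2 ∉ P) ∧
    ∀ s < t, ∀ c ∈ [(l.get s).1, (l.get s).2], c ≠ (l.get t).1 ∧ c ≠ (l.get t).2

lemma isLuckyAfter_cons_zero (d : Fin N → α) (P : Finset (Fin N)) (m : Fin N × Fin N)
    (l : List (Fin N × Fin N)) :
    IsLuckyAfter d P (m :: l) (0 : Fin (l.length + 1)) ↔
      m.1.val + 1 = m.2.val ∧ d m.1 = d m.2 ∧ m.1 ∉ P ∧ m.2 ∉ P := by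
  simp [IsLuckyAfter]

lemma isLuckyAfter_cons_succ (d : Fin N → α) (P : Finset (Fin N)) (m : Fin N × Fin N)
    (l : List (Fin N × Fin N)) (t : Fin l.length) :
    IsLuckyAfter d P (m :: l) t.succ ↔ IsLuckyAfter d (insert m.1 (insert m.2 P)) l t := by
  simp only [IsLuckyAfter, List.length_cons, Fin.forall_fin_succ, Fin.succ_lt_succ_iff,
    Fin.succ_pos, true_implies, List.get_cons_zero, List.mem_cons, List.not_mem_nil,
    or_false, forall_eq_or_imp, forall_eq, Finset.mem_insert,
    not_or]
  refine and_congr_right fun _ => and_congr_right fun _ => ?_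
  rw [← and_assoc]
  exact and_congr_left fun _ => by grind

variable [DecidableEq α]

instance (d : Fin N → α) (P : Finset (Fin N)) (l : List (Fin N × Fin N)) :
    DecidablePred (IsLuckyAfter d P l) := fun t => by
  unfold IsLuckyAfter; infer_instance

/-- The number of lucky moves in a list of moves when the positions in `P` have been flipped
before, by recursion on the list. -/
def luckyCount (d : Fin N → α) : Finset (Fin N) → List (Fin N × Fin N) → ℕ
  | _, [] => 0
  | P, m :: l =>
    (if m.1.val + 1 = m.2.val ∧ d m.1 = d m.2 ∧ m.1 ∉ P ∧ m.2 ∉ P then 1 else 0) +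
      luckyCount d (insert m.1 (insert m.2 P)) l

/-- The number of lucky moves as a function of the word of labels of the unflipped cards, when
`K` is the set of the labels of which no card has been flipped. -/
def luckyWord : Finset α → List α → ℕ
  | _, [] => 0
  | _, [_] => 0
  | K, a :: b :: w =>
    if a ∈ K then (if a = b then 1 else 0) + luckyWord ((K.erase a).erase b) w
    else luckyWord K (b :: w)

lemma card_filter_isLuckyAfter (d : Fin N → α) (P : Finset (Fin N)) (l : List (Fin N × Fin N)) :
    (Finset.univ.filter (IsLuckyAfter d P l)).card = luckyCount d P l := by
  induction l generalizing P with
  | nil => simp [luckyCount]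
  | cons m l ih =>
    simp only [luckyCount, ← ih, ← isLuckyAfter_cons_succ d P m, ← isLuckyAfter_cons_zero d P m l]
    exact Fin.card_filter_univ_succ' (n := l.length) (IsLuckyAfter d P (m :: l))

lemma luckyCount_cons_of_mem {d : Fin N → α} {P : Finset (Fin N)} {m : Fin N × Fin N}
    (hm : m.2 ∈ P) (l : List (Fin N × Fin N)) :
    luckyCount d P (m :: l) = luckyCount d (insert m.1 P) l := by
  simp [luckyCount, hm]

lemma luckyWord_cons_of_notMem {K : Finset α} {a : α} (ha : a ∉ K) (w : List α) :
    luckyWord K (a :: w) = luckyWord K w := by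
  cases w with
  | nil => rfl
  | cons b w => rw [luckyWord, if_neg ha]

lemma luckyWord_cons_cons_of_mem {K : Finset α} {a : α} (ha : a ∈ K) (b : α) (w : List α) :
    luckyWord K (a :: b :: w) =
      (if a = b then 1 else 0) + luckyWord ((K.erase a).erase b) w := by
  rw [luckyWord, if_pos ha]

end Game

namespace Deal

variable {n : ℕ}

lemma luckyMoves_eq_luckyCount (d : Deal n) : d.luckyMoves = luckyCount d.1 ∅ d.moves := by
  rw [← card_filter_isLuckyAfter]
  unfold luckyMoves IsLucky IsLuckyAfter
  simp

/-- The labels of which no card has been flipped. -/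
def unseenLabels (d : Fin (2 * n) → Fin n) (seen : List (Fin (2 * n))) : Finset (Fin n) :=
  (seen.map d).toFinsetᶜ

lemma unseenLabels_cons (d : Fin (2 * n) → Fin n) (a : Fin (2 * n)) (seen : List (Fin (2 * n))) :
    unseenLabels d (a :: seen) = (unseenLabels d seen).erase (d a) := by
  simp [unseenLabels, Finset.compl_insert]

lemma mem_unseenLabels_iff_find? (d : Fin (2 * n) → Fin n) (a : Fin (2 * n))
    (seen : List (Fin (2 * n))) :
    d a ∈ unseenLabels d seen ↔ seen.find? (fun q => d q = d a) = none := by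
  simp [unseenLabels]

lemma luckyCount_play (d : Fin (2 * n) → Fin n) (seen rest : List (Fin (2 * n)))
    (hc : rest.IsChain fun a b => a.val + 1 = b.val) (hd : (rest ++ seen).Nodup) :
    luckyCount d seen.toFinset (play d seen rest) =
      luckyWord (unseenLabels d seen) (rest.map d) := by
  fun_induction play d seen rest with
  | case1 => rfl
  | case2 seen a q ha =>
    exact luckyCount_cons_of_mem (List.mem_toFinset.2 (List.mem_of_find?_eq_some ha)) []
  | case3 => rfl
  | case4 seen a b rest q ha ih =>
    have hq : q ∈ seen.toFinset := List.mem_toFinset.2 (List.mem_of_find?_eq_some ha)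
    have hK : d a ∉ unseenLabels d seen := by simp [mem_unseenLabels_iff_find?, ha]
    have ih := ih hc.tail (List.nodup_middle.2 hd)
    rw [unseenLabels_cons, Finset.erase_eq_of_notMem hK, List.toFinset_cons] at ih
    rw [luckyCount_cons_of_mem hq, ih]
    exact (luckyWord_cons_of_notMem hK _).symm
  | case5 seen a b rest ha hab ih =>
    have hK := (mem_unseenLabels_iff_find? d a seen).2 ha
    have ih := ih hc.tail.tail (by grind)
    have hfresh : a ∉ seen.toFinset ∧ b ∉ seen.toFinset := by
      simp only [List.mem_toFinset]
      grind
    have hadj : a.val + 1 = b.val := by grind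
    simp only [unseenLabels_cons, List.toFinset_cons] at ih
    rw [List.map_cons, List.map_cons, luckyWord_cons_cons_of_mem hK, ← ih, luckyCount,
      if_pos hab, if_pos ⟨hadj, hab, hfresh⟩, Finset.insert_comm]
  | case6 seen a b rest ha hab q hb ih =>
    have hK := (mem_unseenLabels_iff_find? d a seen).2 ha
    have ih := ih hc.tail.tail (by grind)
    have hq : q ∈ seen.toFinset := List.mem_toFinset.2 (List.mem_of_find?_eq_some hb)
    simp only [unseenLabels_cons, List.toFinset_cons] at ih
    rw [List.map_cons, List.map_cons, luckyWord_cons_cons_of_mem hK, ← ih, luckyCount,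
      luckyCount_cons_of_mem (by simp [hq])]
    simp [hab, Finset.insert_comm]
  | case7 seen a b rest ha hab hb ih =>
    have hK := (mem_unseenLabels_iff_find? d a seen).2 ha
    have ih := ih hc.tail.tail (by grind)
    simp only [unseenLabels_cons, List.toFinset_cons] at ih
    rw [List.map_cons, List.map_cons, luckyWord_cons_cons_of_mem hK, ← ih, luckyCount]
    simp [hab, Finset.insert_comm]

lemma luckyMoves_eq_luckyWord (d : Deal n) :
    d.luckyMoves = luckyWord Finset.univ (List.ofFn d.1) := by
  have hchain : (List.finRange (2 * n)).IsChain fun a b => a.val + 1 = b.val := by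
    simp [List.isChain_iff_getElem]
  rw [luckyMoves_eq_luckyCount, moves, List.ofFn_eq_map]
  simpa [unseenLabels] using luckyCount_play d.1 [] _ hchain (by simp [List.nodup_finRange])

end Deal

section MoveAverage

/-- The probability that the next two cards match, when `k` labels have not been seen and `u`
labels have been seen once. -/
noncomputable def matchProb (k u : ℕ) : ℝ := 2 * k / ((2 * k + u) * (2 * k + u - 1))

/-- The proportion of the unflipped cards whose label has not been seen, when `k` labels have not
been seen and `u` labels have been seen once. -/
noncomputable def unseenFraction (k u : ℕ) : ℝ := 2 * k / (2 * k + u)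

/-- The expectation of `f` after the next flip that finds a known label or the next two flips,
from the state with `k` labels not seen and `u` labels seen once, with the event that the two
cards match weighted by `z`. The truncated arguments `u - 1`, `k - 1` and `k - 2` occur with
coefficient zero. -/
noncomputable def moveAverage {A : Type*} [Ring A] [Algebra ℝ A] (z : A) (f : ℕ → ℕ → A)
    (k u : ℕ) : A :=
  (u / (2 * k + u) : ℝ) • f k (u - 1) +
    matchProb k u • ((z + u) * f (k - 1) u + 2 * (k - 1) * f (k - 2) (u + 2))

/-- The probability generating function at `z` of the number of lucky moves from the state with
`k` labels not seen and `u` labels seen once. -/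
noncomputable def luckyPGF (z : ℂ) : ℕ → ℕ → ℂ
  | 0, _ => 1
  | k + 1, 0 => matchProb (k + 1) 0 • (z * luckyPGF z k 0 + 2 * k * luckyPGF z (k - 1) 2)
  | k + 1, u + 1 =>
    ((u + 1) / (2 * (k + 1) + (u + 1)) : ℝ) • luckyPGF z (k + 1) u +
      matchProb (k + 1) (u + 1) •
        ((z + (u + 1)) * luckyPGF z k (u + 1) + 2 * k * luckyPGF z (k - 1) (u + 3))
termination_by k u => (k, u)

lemma luckyPGF_eq_moveAverage (z : ℂ) {k u : ℕ} (h : 0 < 2 * k + u) :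
    luckyPGF z k u = moveAverage z (luckyPGF z) k u := by
  rcases k with _ | k <;> rcases u with _ | u
  · simp at h
  · have hu : (u + 1 : ℂ) ≠ 0 := by exact_mod_cast u.succ_ne_zero
    simp [luckyPGF, moveAverage, matchProb, div_self hu]
  · simp [luckyPGF, moveAverage]
  · simp [luckyPGF, moveAverage]

lemma moveAverage_weights {k u : ℕ} (h : 0 < 2 * k + u) :
    (u / (2 * k + u) : ℝ) + matchProb k u * (1 + u + 2 * (k - 1)) = 1 := by
  have hm : (2 * k + u : ℝ) ≠ 0 := by exact_mod_cast h.ne'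
  obtain rfl | hk := k.eq_zero_or_pos
  · simp_all [matchProb]
  have hm' : (2 * k + u - 1 : ℝ) ≠ 0 := by
    have : (1 : ℝ) ≤ k := by exact_mod_cast hk
    have : (0 : ℝ) ≤ u := u.cast_nonneg
    linarith
  rw [matchProb]
  field_simp
  ring

lemma luckyPGF_one (k u : ℕ) : luckyPGF 1 k u = 1 := by
  have hw : ∀ {k u : ℕ}, 0 < 2 * k + u →
      (u / (2 * k + u) + matchProb k u * (1 + u + 2 * (k - 1)) : ℂ) = 1 := fun h => by
    simpa using congrArg ((↑) : ℝ → ℂ) (moveAverage_weights h)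
  fun_induction luckyPGF 1 k u with
  | case1 => rfl
  | case2 k ihk ihk' =>
    have h := hw (k := k + 1) (u := 0) (by omega)
    push_cast at h
    rw [ihk, ihk', Complex.real_smul]
    linear_combination h
  | case3 k u ihu ihk ihk' =>
    have h := hw (k := k + 1) (u := u + 1) (by omega)
    push_cast at h
    rw [ihu, ihk, ihk', Complex.real_smul, Complex.real_smul]
    push_cast
    linear_combination h

end MoveAverage

section WordCount

/-- The number of words in which `k` labels occur twice and `u` labels occur once. -/
noncomputable def wordCount (k u : ℕ) : ℝ := (2 * k + u).factorial / 2 ^ k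

lemma wordCount_mul_div (k u : ℕ) :
    wordCount k u * (u / (2 * k + u)) = u * wordCount k (u - 1) := by
  rcases u with _ | u
  · simp
  · simp only [wordCount, Nat.add_sub_cancel, ← add_assoc, Nat.factorial_succ]
    push_cast
    rw [← add_assoc]
    field_simp

lemma wordCount_mul_matchProb (k u : ℕ) :
    wordCount k u * matchProb k u = k * wordCount (k - 1) u := by
  rcases k with _ | k
  · simp [matchProb]
  · have hne : (2 * (k + 1) + u - 1 : ℝ) = 2 * k + u + 1 := by ring
    simp only [wordCount, matchProb, Nat.add_sub_cancel,
      show 2 * (k + 1) + u = 2 * k + u + 1 + 1 by ring, Nat.factorial_succ]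
    push_cast
    rw [hne]
    field_simp
    ring

lemma two_mul_wordCount_succ (k u : ℕ) : 2 * wordCount (k + 1) u = wordCount k (u + 2) := by
  rw [wordCount, wordCount, show 2 * (k + 1) + u = 2 * k + (u + 2) by ring, pow_succ]
  field_simp

lemma wordCount_mul_moveAverage (z : ℂ) (f : ℕ → ℕ → ℂ) (k u : ℕ) :
    wordCount k u * moveAverage z f k u =
      u * (wordCount k (u - 1) * f k (u - 1)) +
        k * ((z + u) * (wordCount (k - 1) u * f (k - 1) u) +
          (k - 1 : ℕ) * (wordCount (k - 2) (u + 2) * f (k - 2) (u + 2))) := by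
  have hu := congrArg ((↑) : ℝ → ℂ) (wordCount_mul_div k u)
  have hk := congrArg ((↑) : ℝ → ℂ) (wordCount_mul_matchProb k u)
  have hkk : (k * (2 * (k - 1)) : ℂ) * wordCount (k - 1) u =
      k * (k - 1 : ℕ) * wordCount (k - 2) (u + 2) := by
    rcases k with _ | _ | k
    · simp
    · simp
    · rw [show k + 1 + 1 - 1 = k + 1 by rfl, show k + 1 + 1 - 2 = k by rfl,
        ← two_mul_wordCount_succ]
      push_cast
      ring
  push_cast at hu hk
  simp only [moveAverage, Complex.real_smul]
  push_cast
  linear_combination f k (u - 1) * hu +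
    ((z + u) * f (k - 1) u + 2 * (k - 1) * f (k - 2) (u + 2)) * hk + f (k - 2) (u + 2) * hkk

end WordCount

section Arrangements

variable {α : Type*} [DecidableEq α]

/-- The words with the given multiset of letters. -/
def arrangements (s : Multiset α) : Finset (List α) := s.lists.toFinset

lemma mem_arrangements {s : Multiset α} {w : List α} :
    w ∈ arrangements s ↔ (w : Multiset α) = s := by
  simp [arrangements, eq_comm]

/-- The multiset of labels in which those in `K` occur twice and those in `U` once. -/
def stock (K U : Finset α) : Multiset α := K.val + K.val + U.val

lemma stock_insert_left {K U : Finset α} {a : α} (hK : a ∉ K) (hU : a ∉ U) :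
    stock (insert a K) U = a ::ₘ stock K (insert a U) := by
  simp only [stock, Finset.insert_val_of_notMem hK, Finset.insert_val_of_notMem hU]
  simp [Multiset.cons_add, Multiset.add_cons]

lemma stock_insert_right {K U : Finset α} {a : α} (hU : a ∉ U) :
    stock K (insert a U) = a ::ₘ stock K U := by
  simp only [stock, Finset.insert_val_of_notMem hU]
  simp [Multiset.add_cons]

lemma sum_arrangements {M : Type*} [AddCommMonoid M] {s : Multiset α} (hs : s ≠ 0)
    (f : List α → M) : ∑ w ∈ arrangements s, f w =
      ∑ a ∈ s.toFinset, ∑ w ∈ arrangements (s.erase a), f (a :: w) := by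
  have h : arrangements s = s.toFinset.biUnion fun a =>
      (arrangements (s.erase a)).map ⟨List.cons a, List.cons_injective⟩ := by
    ext w
    simp only [mem_arrangements, Finset.mem_biUnion, Multiset.mem_toFinset, Finset.mem_map,
      Function.Embedding.coeFn_mk]
    constructor
    · rintro rfl
      cases w with
      | nil => simp at hs
      | cons a w => exact ⟨a, by simp, w, by simp, rfl⟩
    · rintro ⟨a, ha, w, hw, rfl⟩
      rw [← Multiset.cons_coe, hw, Multiset.cons_erase ha]
  rw [h, Finset.sum_biUnion]
  · simp
  · intro a _ b _ hab
    simp only [Function.onFun, Finset.disjoint_left, Finset.mem_map, Function.Embedding.coeFn_mk]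
    rintro _ ⟨w, _, rfl⟩ ⟨v, _, h⟩
    exact hab (List.cons.inj h).1.symm

lemma sum_arrangements_stock {M : Type*} [AddCommMonoid M] {K U : Finset α} (hKU : Disjoint K U)
    (hne : (K ∪ U).Nonempty) (f : List α → M) :
    ∑ w ∈ arrangements (stock K U), f w =
      ∑ a ∈ U, ∑ w ∈ arrangements (stock K (U.erase a)), f (a :: w) +
      ∑ a ∈ K, ∑ w ∈ arrangements (stock (K.erase a) (insert a U)), f (a :: w) := by
  have hto : (stock K U).toFinset = U ∪ K := by
    ext a
    simp [stock, or_comm]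
  rw [sum_arrangements, hto, Finset.sum_union hKU.symm]
  · congr 1
    · refine Finset.sum_congr rfl fun a ha => ?_
      congr 2
      conv_lhs => rw [← Finset.insert_erase ha, stock_insert_right (Finset.notMem_erase a U)]
      simp
    · refine Finset.sum_congr rfl fun a ha => ?_
      congr 2
      conv_lhs => rw [← Finset.insert_erase ha, stock_insert_left (Finset.notMem_erase a K)
        (Finset.disjoint_left.1 hKU ha)]
      simp
  · intro h
    rw [h] at hto
    rw [Finset.union_comm, ← hto] at hne
    simp at hne

/-- The generating function at `z` of the number of lucky moves of the words in which the labels in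
`K` occur twice and those in `U` once, when exactly the labels in `K` have not been seen. -/
def luckySum (z : ℂ) (K U : Finset α) : ℂ :=
  ∑ w ∈ arrangements (stock K U), z ^ luckyWord K w

lemma luckySum_empty (z : ℂ) : luckySum z (∅ : Finset α) ∅ = 1 := by
  have h : arrangements (stock (∅ : Finset α) ∅) = {[]} := by
    ext w
    simp [mem_arrangements, stock]
  simp [luckySum, h, luckyWord]

lemma sum_arrangements_of_unseen (z : ℂ) {K U : Finset α} (hKU : Disjoint K U) {a : α}
    (ha : a ∈ K) :
    ∑ w ∈ arrangements (stock (K.erase a) (insert a U)), z ^ luckyWord K (a :: w) =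
      z * luckySum z (K.erase a) U +
        ∑ b ∈ U, luckySum z (K.erase a) ((insert a U).erase b) +
        ∑ b ∈ K.erase a, luckySum z ((K.erase a).erase b) (insert b (insert a U)) := by
  have haU : a ∉ U := Finset.disjoint_left.1 hKU ha
  have hdisj : Disjoint (K.erase a) (insert a U) := by
    simpa using hKU.mono_left (K.erase_subset a)
  rw [sum_arrangements_stock hdisj (by simp), Finset.sum_insert haU, Finset.erase_insert haU]
  simp only [luckyWord_cons_cons_of_mem ha, luckySum, Finset.mul_sum]
  congr 1
  · congr 1
    · simp [pow_add]
    · refine Finset.sum_congr rfl fun b hb => Finset.sum_congr rfl fun w _ => ?_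
      have hab : a ≠ b := fun h => haU (h ▸ hb)
      have hbK : b ∉ K.erase a := fun h => Finset.disjoint_left.1 hKU (Finset.mem_of_mem_erase h) hb
      rw [if_neg hab, zero_add, Finset.erase_eq_of_notMem hbK]
  · refine Finset.sum_congr rfl fun b hb => Finset.sum_congr rfl fun w _ => ?_
    rw [if_neg (Finset.ne_of_mem_erase hb).symm, zero_add]

lemma luckySum_recursion (z : ℂ) {K U : Finset α} (hKU : Disjoint K U) (hne : (K ∪ U).Nonempty) :
    luckySum z K U = ∑ a ∈ U, luckySum z K (U.erase a) +
      ∑ a ∈ K, (z * luckySum z (K.erase a) U +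
        ∑ b ∈ U, luckySum z (K.erase a) ((insert a U).erase b) +
        ∑ b ∈ K.erase a, luckySum z ((K.erase a).erase b) (insert b (insert a U))) := by
  rw [luckySum, sum_arrangements_stock hKU hne]
  congr 1
  · refine Finset.sum_congr rfl fun a ha => Finset.sum_congr rfl fun w _ => ?_
    rw [luckyWord_cons_of_notMem (Finset.disjoint_right.1 hKU ha)]
  · exact Finset.sum_congr rfl fun a ha => sum_arrangements_of_unseen z hKU ha

lemma luckySum_recursion_card (z : ℂ) {K U : Finset α} (hKU : Disjoint K U)
    (hne : (K ∪ U).Nonempty) {W : ℕ → ℕ → ℂ}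
    (hW : ∀ K' U' : Finset α, Disjoint K' U' → 2 * K'.card + U'.card < 2 * K.card + U.card →
      luckySum z K' U' = W K'.card U'.card) :
    luckySum z K U = U.card * W K.card (U.card - 1) +
      K.card * ((z + U.card) * W (K.card - 1) U.card +
        (K.card - 1 : ℕ) * W (K.card - 2) (U.card + 2)) := by
  have hseen : ∀ a ∈ U, luckySum z K (U.erase a) = W K.card (U.card - 1) := fun a ha => by
    rw [hW _ _ (by grind [Finset.disjoint_left]) (by grind), Finset.card_erase_of_mem ha]
  have hunseen : ∀ a ∈ K, z * luckySum z (K.erase a) U +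
      ∑ b ∈ U, luckySum z (K.erase a) ((insert a U).erase b) +
      ∑ b ∈ K.erase a, luckySum z ((K.erase a).erase b) (insert b (insert a U)) =
        (z + U.card) * W (K.card - 1) U.card +
          (K.card - 1 : ℕ) * W (K.card - 2) (U.card + 2) := fun a ha => by
    have haU : a ∉ U := Finset.disjoint_left.1 hKU ha
    have hKa : (K.erase a).card = K.card - 1 := Finset.card_erase_of_mem ha
    have hUa : (insert a U).card = U.card + 1 := Finset.card_insert_of_notMem haU
    have hmatch : luckySum z (K.erase a) U = W (K.card - 1) U.card := by
      rw [hW _ _ (by grind [Finset.disjoint_left]) (by grind), hKa]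
    have hknown : ∀ b ∈ U, luckySum z (K.erase a) ((insert a U).erase b) =
        W (K.card - 1) U.card := fun b hb => by
      rw [hW _ _ (by grind [Finset.disjoint_left]) (by grind), hKa,
        Finset.card_erase_of_mem (Finset.mem_insert_of_mem hb), hUa, Nat.add_sub_cancel]
    have hnew : ∀ b ∈ K.erase a, luckySum z ((K.erase a).erase b) (insert b (insert a U)) =
        W (K.card - 2) (U.card + 2) := fun b hb => by
      rw [hW _ _ (by grind [Finset.disjoint_left]) (by grind), Finset.card_erase_of_mem hb, hKa,
        Finset.card_insert_of_notMem (by grind [Finset.disjoint_left]), hUa, Nat.sub_sub]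
    rw [hmatch, Finset.sum_congr rfl hknown, Finset.sum_congr rfl hnew]
    simp only [Finset.sum_const, nsmul_eq_mul, hKa]
    ring
  rw [luckySum_recursion z hKU hne, Finset.sum_congr rfl hseen, Finset.sum_congr rfl hunseen]
  simp only [Finset.sum_const, nsmul_eq_mul]

lemma luckySum_eq (z : ℂ) {K U : Finset α} (hKU : Disjoint K U) :
    luckySum z K U = wordCount K.card U.card * luckyPGF z K.card U.card := by
  induction hm : 2 * K.card + U.card using Nat.strong_induction_on generalizing K U with
  | _ m ih =>
  subst hm
  obtain hempty | hne := (K ∪ U).eq_empty_or_nonempty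
  · obtain ⟨rfl, rfl⟩ := Finset.union_eq_empty.1 hempty
    simp [luckySum_empty, wordCount, luckyPGF]
  have hpos : 0 < 2 * K.card + U.card := by
    have := Finset.card_pos.2 hne
    have := Finset.card_union_le K U
    omega
  rw [luckySum_recursion_card z hKU hne (W := fun k u => wordCount k u * luckyPGF z k u)
      fun K' U' hKU' hlt => ih _ hlt hKU' rfl,
    luckyPGF_eq_moveAverage z hpos, wordCount_mul_moveAverage]

lemma card_arrangements_stock {K U : Finset α} (hKU : Disjoint K U) :
    ((arrangements (stock K U)).card : ℂ) = wordCount K.card U.card := by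
  simpa [luckySum, luckyPGF_one] using luckySum_eq 1 hKU

end Arrangements

section Deals

variable {n : ℕ}

lemma ofFn_mem_arrangements (d : Fin (2 * n) → Fin n) :
    List.ofFn d ∈ arrangements (stock (Finset.univ : Finset (Fin n)) ∅) ↔
      ∀ i, (Finset.univ.filter fun j => d j = i).card = 2 := by
  rw [mem_arrangements, Multiset.ext]
  refine forall_congr' fun i => ?_
  rw [← Fin.univ_val_map, Multiset.count_map]
  simp only [eq_comm (a := i)]
  simp [stock, Finset.card_def, Finset.filter_val]

lemma sum_deal {M : Type*} [AddCommMonoid M] (f : List (Fin n) → M) :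
    ∑ d : Deal n, f (List.ofFn d.1) =
      ∑ w ∈ arrangements (stock (Finset.univ : Finset (Fin n)) ∅), f w := by
  refine Finset.sum_bij (fun d _ => List.ofFn d.1)
    (fun d _ => (ofFn_mem_arrangements d.1).2 d.2)
    (fun d _ e _ h => Subtype.ext (List.ofFn_injective h)) (fun w hw => ?_) (fun _ _ => rfl)
  have hlen : w.length = 2 * n := by
    have hcard := congrArg Multiset.card (mem_arrangements.1 hw)
    rw [Multiset.coe_card] at hcard
    simp [hcard, stock, two_mul]
  obtain ⟨d, rfl⟩ : ∃ d : Fin (2 * n) → Fin n, List.ofFn d = w :=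
    ⟨fun i => w.get (i.cast hlen.symm), List.ext_getElem (by simp [hlen]) (by simp)⟩
  exact ⟨⟨d, (ofFn_mem_arrangements d).1 hw⟩, Finset.mem_univ _, rfl⟩

lemma card_deal (n : ℕ) : (Fintype.card (Deal n) : ℂ) = wordCount n 0 := by
  have hsum := sum_deal (n := n) fun _ => 1
  rw [← Finset.card_eq_sum_ones, ← Finset.card_eq_sum_ones] at hsum
  rw [← Finset.card_univ, hsum, card_arrangements_stock (Finset.disjoint_empty_right _)]
  simp

lemma sum_pow_luckyMoves (z : ℂ) (n : ℕ) :
    ∑ d : Deal n, z ^ d.luckyMoves = wordCount n 0 * luckyPGF z n 0 := by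
  have h := luckySum_eq z (Finset.disjoint_empty_right (Finset.univ : Finset (Fin n)))
  rw [luckySum, ← sum_deal] at h
  simpa [← Deal.luckyMoves_eq_luckyWord] using h

lemma charFun_luckyMoves (n : ℕ) (t : ℝ) :
    charFun ((uniformDeal n).map fun d : Deal n => (d.luckyMoves : ℝ)) t =
      luckyPGF (Complex.exp (t * Complex.I)) n 0 := by
  have hcard : (Fintype.card (Deal n) : ℂ) ≠ 0 := by exact_mod_cast Fintype.card_ne_zero
  have hexp : ∀ d : Deal n, Complex.exp (t * d.luckyMoves * Complex.I) =
      Complex.exp (t * Complex.I) ^ d.luckyMoves := fun d => by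
    rw [← Complex.exp_nat_mul]
    ring_nf
  rw [charFun_apply_real, integral_map (by fun_prop) (by fun_prop), uniformDeal,
    PMF.integral_eq_sum]
  simp only [PMF.uniformOfFintype_apply, ENNReal.toReal_inv, ENNReal.toReal_natCast,
    Complex.real_smul, Complex.ofReal_inv, Complex.ofReal_natCast, hexp]
  rw [← Finset.mul_sum, sum_pow_luckyMoves, ← card_deal, inv_mul_cancel_left₀ hcard]

end Deals

section LimitPGF

lemma norm_image_sub_sub_smul_le {E : Type*} [NormedAddCommGroup E] [NormedSpace ℝ E]
    {f f' : ℝ → E} {s : Set ℝ} {C : NNReal} (hs : Convex ℝ s)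
    (hf : ∀ x ∈ s, HasDerivWithinAt f (f' x) s x) (hf' : LipschitzOnWith C f' s) {x y : ℝ}
    (hx : x ∈ s) (hy : y ∈ s) : ‖f y - f x - (y - x) • f' x‖ ≤ C * (y - x) ^ 2 := by
  have hsub : Set.uIcc x y ⊆ s := hs.ordConnected.uIcc_subset hx hy
  have hderiv : ∀ t ∈ Set.uIcc x y,
      HasDerivWithinAt (fun t => f t - t • f' x) (f' t - f' x) (Set.uIcc x y) t := fun t ht => by
    simpa only [id_eq, one_smul] using ((hf t (hsub ht)).mono hsub).fun_sub
      ((hasDerivWithinAt_id t (Set.uIcc x y)).smul_const (f' x))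
  have hbound : ∀ t ∈ Set.uIcc x y, ‖f' t - f' x‖ ≤ C * |y - x| := fun t ht =>
    (hf'.norm_sub_le (hsub ht) hx).trans <| by
      gcongr
      exact Set.abs_sub_left_of_mem_uIcc ht
  have h := (convex_uIcc x y).norm_image_sub_le_of_norm_hasDerivWithin_le hderiv hbound
    Set.left_mem_uIcc Set.right_mem_uIcc
  calc ‖f y - f x - (y - x) • f' x‖ = ‖f y - y • f' x - (f x - x • f' x)‖ := by
        congr 1
        module
    _ ≤ C * |y - x| * ‖y - x‖ := h
    _ = C * (y - x) ^ 2 := by rw [Real.norm_eq_abs, mul_assoc, ← pow_two, sq_abs]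

/-- The solution of `(1 + y) * f' y = (z - 1) * f y` with `f 0 = 1`: the limit of the generating
function `luckyPGF z` when the proportion of unseen cards is `y`. -/
noncomputable def limitPGF (z : ℂ) (y : ℝ) : ℂ := (1 + y : ℂ) ^ (z - 1)

lemma hasDerivAt_limitPGF (z : ℂ) {y : ℝ} (hy : 0 ≤ y) :
    HasDerivAt (limitPGF z) ((z - 1) * limitPGF (z - 1) y) y := by
  have hslit : (1 + y : ℂ) ∈ Complex.slitPlane := by
    refine Or.inl ?_
    simp only [Complex.add_re, Complex.one_re, Complex.ofReal_re]
    positivity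
  have h := ((hasDerivAt_id (y : ℂ)).const_add 1).cpow_const (c := z - 1) hslit
  exact (mul_one ((z - 1) * _)) ▸ h.comp_ofReal

lemma one_add_mul_limitPGF (z : ℂ) {y : ℝ} (hy : 0 ≤ y) :
    (1 + y) * limitPGF (z - 1) y = limitPGF z y := by
  have hne : (1 + y : ℂ) ≠ 0 := by exact_mod_cast (by positivity : 1 + y ≠ 0)
  rw [limitPGF, limitPGF, Complex.cpow_sub _ _ hne, Complex.cpow_one, mul_div_cancel₀ _ hne]

lemma exists_lipschitzOnWith_deriv_limitPGF (z : ℂ) :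
    ∃ C, LipschitzOnWith C (fun y => (z - 1) * limitPGF (z - 1) y) (Set.Icc 0 1) := by
  have hderiv : ∀ (w : ℂ), ∀ y ∈ Set.Icc (0 : ℝ) 1,
      HasDerivAt (limitPGF w) ((w - 1) * limitPGF (w - 1) y) y :=
    fun w y hy => hasDerivAt_limitPGF w hy.1
  have hcont : ContinuousOn (fun y => (z - 1) * ((z - 1 - 1) * limitPGF (z - 1 - 1) y))
      (Set.Icc 0 1) := fun y hy =>
    (continuousAt_const.mul (continuousAt_const.mul
      (hderiv _ y hy).continuousAt)).continuousWithinAt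
  obtain ⟨C, hC⟩ := isCompact_Icc.exists_bound_of_continuousOn hcont
  exact ⟨C.toNNReal, (convex_Icc 0 1).lipschitzOnWith_of_nnnorm_hasDerivWithin_le
    (fun y hy => ((hderiv _ y hy).const_mul (z - 1)).hasDerivWithinAt)
    fun y hy => NNReal.le_toNNReal_of_coe_le (hC y hy)⟩

lemma limitPGF_one (z : ℂ) : limitPGF z 1 = Complex.exp (Real.log 2 * (z - 1)) := by
  rw [limitPGF, Complex.ofReal_one, one_add_one_eq_two, Complex.cpow_def_of_ne_zero two_ne_zero,
    Complex.ofReal_log zero_le_two, Complex.ofReal_ofNat]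

end LimitPGF

section UnseenFraction

lemma matchProb_nonneg (k u : ℕ) : 0 ≤ matchProb k u := by
  rcases k with _ | k
  · simp [matchProb]
  · have h : (0 : ℝ) ≤ 2 * (k + 1 : ℕ) + u - 1 := by
      push_cast
      linarith [(k.cast_nonneg : (0 : ℝ) ≤ k), (u.cast_nonneg : (0 : ℝ) ≤ u)]
    unfold matchProb
    positivity

lemma mul_matchProb_le_one (k u : ℕ) : u * matchProb k u ≤ 1 := by
  rcases k with _ | k
  · simp [matchProb]
  · have hk := k.cast_nonneg (α := ℝ)
    have hu := u.cast_nonneg (α := ℝ)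
    rw [matchProb, ← mul_div_assoc]
    push_cast
    exact div_le_one_of_le₀ (by nlinarith [hk, hu])
      (mul_nonneg (by linarith [hk, hu]) (by linarith [hk, hu]))

lemma unseenFraction_mem_Icc (k u : ℕ) : unseenFraction k u ∈ Set.Icc (0 : ℝ) 1 := by
  unfold unseenFraction
  exact ⟨by positivity, div_le_one_of_le₀ (by simp) (by positivity)⟩

lemma unseenFraction_sub_right (k u : ℕ) :
    unseenFraction k u - unseenFraction k (u + 1) = matchProb k (u + 1) := by
  rcases k with _ | k
  · simp [unseenFraction, matchProb]
  · simp only [unseenFraction, matchProb]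
    push_cast
    rw [← add_assoc, add_sub_cancel_right]
    field_simp
    ring

lemma mul_sq_unseenFraction_sub_right_le (k u : ℕ) :
    u / (2 * k + u) * (unseenFraction k (u - 1) - unseenFraction k u) ^ 2 ≤
      matchProb k u / (2 * k + u) := by
  have hq := matchProb_nonneg k u
  rcases u with _ | u
  · simpa using div_nonneg hq (by positivity)
  rw [Nat.add_sub_cancel, unseenFraction_sub_right]
  set q := matchProb k (u + 1)
  calc _ = (u + 1 : ℕ) * q * (q / (2 * k + (u + 1 : ℕ))) := by ring
    _ ≤ q / (2 * k + (u + 1 : ℕ)) :=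
      mul_le_of_le_one_left (by positivity) (mul_matchProb_le_one _ _)

lemma abs_unseenFraction_sub_left_le (k u : ℕ) :
    |unseenFraction (k - 1) u - unseenFraction k u| ≤ 2 / (2 * k + u) := by
  rcases k with _ | k
  · simp only [zero_tsub, sub_self, abs_zero]
    positivity
  obtain h | h := Nat.eq_zero_or_pos (2 * k + u)
  · obtain ⟨rfl, rfl⟩ : k = 0 ∧ u = 0 := by omega
    simp [unseenFraction]
  have hm : (0 : ℝ) < 2 * k + u := by exact_mod_cast h
  have heq : unseenFraction k u - unseenFraction (k + 1) u =
      -(2 / (2 * (k + 1 : ℕ) + u) * (u / (2 * k + u))) := by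
    simp only [unseenFraction]
    push_cast
    field_simp
    ring
  rw [Nat.add_sub_cancel, heq, abs_neg, abs_of_nonneg (by positivity)]
  exact mul_le_of_le_one_right (by positivity) (div_le_one_of_le₀ (by simp) hm.le)

lemma abs_unseenFraction_sub_diag_le (k u : ℕ) :
    |unseenFraction (k - 2) (u + 2) - unseenFraction k u| ≤ 4 / (2 * k + u) := by
  rcases k with _ | _ | k
  · simp only [unseenFraction, zero_tsub, Nat.cast_zero, mul_zero, zero_div, sub_zero, abs_zero]
    positivity
  · simp only [unseenFraction, Nat.reduceSubDiff, Nat.cast_zero, mul_zero, zero_div, zero_sub,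
      abs_neg]
    rw [abs_of_nonneg (by positivity)]
    gcongr
    norm_num
  have heq : unseenFraction k (u + 2) - unseenFraction (k + 2) u =
      -(4 / (2 * (k + 2 : ℕ) + u) * ((k + u + 2) / (2 * k + u + 2))) := by
    simp only [unseenFraction]
    push_cast
    field_simp
    ring
  rw [show k + 1 + 1 - 2 = k from rfl, heq, abs_neg, abs_of_nonneg (by positivity)]
  refine mul_le_of_le_one_right (by positivity) (div_le_one_of_le₀ ?_ (by positivity))
  linarith [(k.cast_nonneg : (0 : ℝ) ≤ k)]

end UnseenFraction

section Moments

variable {A : Type*} [Ring A] [Algebra ℝ A] {k u : ℕ}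

lemma moveAverage_sub (z : A) (f g : ℕ → ℕ → A) :
    moveAverage z (fun j v => f j v - g j v) k u = moveAverage z f k u - moveAverage z g k u := by
  simp only [moveAverage, mul_sub, smul_sub, smul_add]
  abel

lemma moveAverage_const_mul (c : ℝ) (f : ℕ → ℕ → ℝ) :
    moveAverage 1 (fun j v => c * f j v) k u = c * moveAverage 1 f k u := by
  simp only [moveAverage, smul_eq_mul]
  ring

lemma moveAverage_eq_add (z : A) (f : ℕ → ℕ → A) :
    moveAverage z f k u = moveAverage 1 f k u + matchProb k u • ((z - 1) * f (k - 1) u) := by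
  simp only [moveAverage, add_mul, sub_mul, smul_add, smul_sub]
  abel

lemma moveAverage_sub_sub_mul (h : 0 < 2 * k + u) (f : ℕ → ℕ → ℂ) (g : ℕ → ℕ → ℝ) (a c : ℂ)
    (b : ℝ) :
    moveAverage 1 (fun j v => f j v - a - (g j v - b) • c) k u =
      moveAverage 1 f k u - a - (moveAverage 1 g k u - b) • c := by
  have hw := congrArg ((↑) : ℝ → ℂ) (moveAverage_weights h)
  push_cast at hw
  simp only [moveAverage, Complex.real_smul, smul_eq_mul]
  push_cast
  linear_combination (b * c - a) * hw

lemma moveAverage_one_mono {f g : ℕ → ℕ → ℝ}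
    (h : ∀ j v, 2 * j + v < 2 * k + u → f j v ≤ g j v) :
    moveAverage 1 f k u ≤ moveAverage 1 g k u := by
  have hq := matchProb_nonneg k u
  refine add_le_add ?_ ?_
  · rcases u with _ | u
    · simp
    · exact smul_le_smul_of_nonneg_left (h _ _ (by omega)) (by positivity)
  · rcases k with _ | k
    · simp [matchProb]
    refine smul_le_smul_of_nonneg_left (add_le_add ?_ ?_) hq
    · exact mul_le_mul_of_nonneg_left (h _ _ (by omega)) (by positivity)
    · rcases k with _ | k
      · simp
      · refine mul_le_mul_of_nonneg_left (h _ _ (by omega)) ?_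
        push_cast
        linarith [(k.cast_nonneg : (0 : ℝ) ≤ k)]

lemma norm_moveAverage_le {z : ℂ} (hz : ‖z‖ ≤ 1) (f : ℕ → ℕ → ℂ) :
    ‖moveAverage z f k u‖ ≤ moveAverage 1 (fun j v => ‖f j v‖) k u := by
  have hq := matchProb_nonneg k u
  refine (norm_add_le _ _).trans (add_le_add ?_ ?_)
  · rw [norm_smul, smul_eq_mul, Real.norm_of_nonneg (by positivity)]
  · rcases k with _ | k
    · simp [matchProb]
    rw [norm_smul, smul_eq_mul, Real.norm_of_nonneg hq]
    refine mul_le_mul_of_nonneg_left ((norm_add_le _ _).trans (add_le_add ?_ ?_)) hq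
    · rw [norm_mul]
      gcongr
      exact (norm_add_le _ _).trans (add_le_add hz (by simp))
    · simp

lemma moveAverage_unseenFraction (k u : ℕ) :
    moveAverage 1 unseenFraction k u =
      unseenFraction k u - matchProb k u * (1 + unseenFraction (k - 1) u) := by
  rcases k with _ | _ | k <;> rcases u with _ | u <;>
    simp [moveAverage, unseenFraction, matchProb] <;> ring_nf <;> field_simp <;> ring

lemma moveAverage_matchProb_le (k u : ℕ) : moveAverage 1 matchProb k u ≤ matchProb k u := by
  by_cases h : k = 1 ∧ u = 0
  · obtain ⟨rfl, rfl⟩ := h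
    norm_num [moveAverage, matchProb]
  refine le_of_eq ?_
  rcases k with _ | _ | k <;> rcases u with _ | u <;>
    simp [moveAverage, matchProb] at h ⊢ <;> ring_nf <;> field_simp <;> ring

lemma moveAverage_sq_unseenFraction_sub_le (k u : ℕ) :
    moveAverage 1 (fun j v => (unseenFraction j v - unseenFraction k u) ^ 2) k u ≤
      17 * (matchProb k u / (2 * k + u)) := by
  rcases k with _ | k
  · simp [moveAverage, matchProb, unseenFraction]
  set q := matchProb (k + 1) u with hq_def
  have hq : 0 ≤ q := matchProb_nonneg _ _
  set m : ℝ := 2 * (k + 1 : ℕ) + u with hm_def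
  have hm : 2 * (k + 1 : ℝ) + u = m := by rw [hm_def, Nat.cast_succ]
  have hm0 : 0 < m := by positivity
  have hleft : (unseenFraction k u - unseenFraction (k + 1) u) ^ 2 ≤ (4 / m) ^ 2 := by
    rw [← sq_abs]
    gcongr
    exact (abs_unseenFraction_sub_left_le (k + 1) u).trans (by gcongr; norm_num)
  have hdiag : (unseenFraction (k - 1) (u + 2) - unseenFraction (k + 1) u) ^ 2 ≤ (4 / m) ^ 2 := by
    rw [← sq_abs]
    gcongr
    exact abs_unseenFraction_sub_diag_le (k + 1) u
  calc _ = u / m * (unseenFraction (k + 1) (u - 1) - unseenFraction (k + 1) u) ^ 2 +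
        q * ((1 + u) * (unseenFraction k u - unseenFraction (k + 1) u) ^ 2 +
          2 * k * (unseenFraction (k - 1) (u + 2) - unseenFraction (k + 1) u) ^ 2) := by
        simp [moveAverage, ← hq_def, hm]
    _ ≤ q / m + q * ((1 + u) * (4 / m) ^ 2 + 2 * k * (4 / m) ^ 2) := by
        gcongr
        exact mul_sq_unseenFraction_sub_right_le (k + 1) u
    _ = q / m + 16 * (q / m) * ((m - 1) / m) := by
        rw [← hm]
        field_simp
        ring
    _ ≤ q / m + 16 * (q / m) * 1 := by
        gcongr
        exact div_le_one_of_le₀ (by linarith) hm0.le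
    _ = 17 * (q / m) := by ring

end Moments

section Comparison

variable {k u : ℕ}

lemma norm_moveAverage_unseenFraction_sub_sub_smul_le {f f' : ℝ → ℂ} {C : NNReal}
    (hf : ∀ y ∈ Set.Icc (0 : ℝ) 1, HasDerivWithinAt f (f' y) (Set.Icc 0 1) y)
    (hf' : LipschitzOnWith C f' (Set.Icc 0 1)) (h : 0 < 2 * k + u) :
    ‖moveAverage 1 (fun j v => f (unseenFraction j v)) k u - f (unseenFraction k u) -
        (moveAverage 1 unseenFraction k u - unseenFraction k u) • f' (unseenFraction k u)‖ ≤
      17 * C * (matchProb k u / (2 * k + u)) := by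
  rw [← moveAverage_sub_sub_mul h]
  refine (norm_moveAverage_le (by simp) _).trans
    ((moveAverage_one_mono fun j v _ => norm_image_sub_sub_smul_le (convex_Icc 0 1) hf hf'
      (unseenFraction_mem_Icc _ _) (unseenFraction_mem_Icc _ _)).trans ?_)
  rw [moveAverage_const_mul, mul_comm (17 : ℝ), mul_assoc]
  gcongr
  exact moveAverage_sq_unseenFraction_sub_le k u

lemma exists_norm_moveAverage_limitPGF_sub_le (z : ℂ) :
    ∃ C : ℝ, 0 ≤ C ∧ ∀ k u, 0 < 2 * k + u →
      ‖moveAverage z (fun j v => limitPGF z (unseenFraction j v)) k u -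
        limitPGF z (unseenFraction k u)‖ ≤ C * (matchProb k u / (2 * k + u)) := by
  obtain ⟨C, hC⟩ := exists_lipschitzOnWith_deriv_limitPGF z
  refine ⟨21 * C, by positivity, fun k u h => ?_⟩
  set φ' : ℝ → ℂ := fun y => (z - 1) * limitPGF (z - 1) y with hφ'
  set y := unseenFraction k u
  set y₂ := unseenFraction (k - 1) u
  set q := matchProb k u
  have hq : 0 ≤ q := matchProb_nonneg k u
  have hy₂ : y₂ ∈ Set.Icc (0 : ℝ) 1 := unseenFraction_mem_Icc _ _
  have hode : (z - 1) * limitPGF z y₂ = (1 + y₂) * φ' y₂ := by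
    rw [← one_add_mul_limitPGF z hy₂.1, hφ']
    ring
  have hsplit : moveAverage z (fun j v => limitPGF z (unseenFraction j v)) k u - limitPGF z y =
      (moveAverage 1 (fun j v => limitPGF z (unseenFraction j v)) k u - limitPGF z y -
        (moveAverage 1 unseenFraction k u - y) • φ' y) + (q * (1 + y₂)) • (φ' y₂ - φ' y) := by
    rw [moveAverage_eq_add z, moveAverage_unseenFraction, hode]
    simp only [Complex.real_smul]
    push_cast
    ring
  have htaylor := norm_moveAverage_unseenFraction_sub_sub_smul_le
    (fun t ht => (hasDerivAt_limitPGF z ht.1).hasDerivWithinAt) hC h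
  have hcorrection : ‖(q * (1 + y₂)) • (φ' y₂ - φ' y)‖ ≤ q * 2 * (C * (2 / (2 * k + u))) := by
    rw [norm_smul, Real.norm_of_nonneg (mul_nonneg hq (by linarith [hy₂.1]))]
    gcongr
    · linarith [hy₂.2]
    · refine (hC.norm_sub_le hy₂ (unseenFraction_mem_Icc k u)).trans ?_
      gcongr
      exact abs_unseenFraction_sub_left_le k u
  calc _ ≤ 17 * C * (q / (2 * k + u)) + q * 2 * (C * (2 / (2 * k + u))) :=
        hsplit ▸ norm_add_le_of_le htaylor hcorrection
    _ = 21 * C * (q / (2 * k + u)) := by ring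

lemma monotone_harmonic : Monotone harmonic :=
  monotone_nat_of_le_succ fun n => by
    rw [harmonic_succ]
    exact le_add_of_nonneg_right (by positivity)

lemma harmonic_nonneg (n : ℕ) : 0 ≤ harmonic n := monotone_harmonic n.zero_le

/-- The shape of the bound on `luckyPGF z k u - limitPGF z (unseenFraction k u)`. The harmonic
factor makes it decrease, on average over a move, by at least `matchProb k u / (2 * k + u)`. -/
noncomputable def errorBound (k u : ℕ) : ℝ := matchProb k u * harmonic (2 * k + u)

lemma moveAverage_errorBound_add_le (h : 0 < 2 * k + u) :
    moveAverage 1 errorBound k u + matchProb k u / (2 * k + u) ≤ errorBound k u := by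
  obtain ⟨m, hm⟩ := Nat.exists_eq_add_one.2 h
  have hharm : (harmonic (2 * k + u) : ℝ) = harmonic m + 1 / (2 * k + u) := by
    rw [hm, harmonic_succ, ← hm]
    push_cast
    ring
  calc moveAverage 1 errorBound k u + matchProb k u / (2 * k + u)
      ≤ moveAverage 1 (fun j v => harmonic m * matchProb j v) k u +
        matchProb k u / (2 * k + u) := by
        gcongr
        refine moveAverage_one_mono fun j v hjv => ?_
        rw [errorBound, mul_comm]
        gcongr
        · exact matchProb_nonneg j v
        · exact_mod_cast monotone_harmonic (by omega)
    _ ≤ harmonic m * matchProb k u + matchProb k u / (2 * k + u) := by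
        rw [moveAverage_const_mul]
        gcongr
        · exact_mod_cast harmonic_nonneg m
        · exact moveAverage_matchProb_le k u
    _ = errorBound k u := by
        rw [errorBound, hharm]
        ring

lemma exists_norm_luckyPGF_sub_limitPGF_le {z : ℂ} (hz : ‖z‖ ≤ 1) :
    ∃ C : ℝ, ∀ k u,
      ‖luckyPGF z k u - limitPGF z (unseenFraction k u)‖ ≤ C * errorBound k u := by
  obtain ⟨C, hC0, hC⟩ := exists_norm_moveAverage_limitPGF_sub_le z
  refine ⟨C, fun k u => ?_⟩
  induction hm : 2 * k + u using Nat.strong_induction_on generalizing k u with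
  | _ m ih =>
    obtain h | h := Nat.eq_zero_or_pos (2 * k + u)
    · obtain ⟨rfl, rfl⟩ : k = 0 ∧ u = 0 := by omega
      simp [luckyPGF, limitPGF, unseenFraction, errorBound]
    set g : ℕ → ℕ → ℂ := fun j v => limitPGF z (unseenFraction j v)
    calc ‖luckyPGF z k u - g k u‖
        = ‖moveAverage z (fun j v => luckyPGF z j v - g j v) k u +
            (moveAverage z g k u - g k u)‖ := by
          rw [moveAverage_sub, luckyPGF_eq_moveAverage z h, sub_add_sub_cancel]
      _ ≤ moveAverage 1 (fun j v => C * errorBound j v) k u +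
            C * (matchProb k u / (2 * k + u)) :=
          norm_add_le_of_le ((norm_moveAverage_le hz _).trans
            (moveAverage_one_mono fun j v hjv => ih _ (hm ▸ hjv) j v rfl)) (hC k u h)
      _ = C * (moveAverage 1 errorBound k u + matchProb k u / (2 * k + u)) := by
          rw [moveAverage_const_mul, mul_add]
      _ ≤ C * errorBound k u := by
          gcongr
          exact moveAverage_errorBound_add_le h

lemma tendsto_harmonic_div : Tendsto (fun n => (harmonic n : ℝ) / n) atTop (nhds 0) := by
  refine (tendsto_one_div_add_atTop_nhds_zero_nat (𝕜 := ℝ)).cesaro.congr fun n => ?_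
  simp [harmonic, div_eq_inv_mul]

lemma tendsto_errorBound : Tendsto (fun n => errorBound n 0) atTop (nhds 0) := by
  have hdouble : Tendsto (fun n : ℕ => 2 * n) atTop atTop :=
    tendsto_id.const_mul_atTop' two_pos
  have hlim := (tendsto_harmonic_div.comp hdouble).const_mul 2
  rw [mul_zero] at hlim
  refine squeeze_zero (fun n => ?_) (fun n => ?_) hlim
  · exact mul_nonneg (matchProb_nonneg n 0) (by exact_mod_cast harmonic_nonneg _)
  · rcases n with _ | n
    · simp [errorBound]
    · have hn : (0 : ℝ) < 2 * (n + 1) - 1 := by linarith [(n.cast_nonneg : (0 : ℝ) ≤ n)]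
      have hmatch : matchProb (n + 1) 0 ≤ 2 / (2 * (n + 1)) := by
        simp only [matchProb]
        push_cast
        rw [add_zero, div_le_div_iff₀ (by positivity) (by positivity)]
        nlinarith
      have hharm : (0 : ℝ) ≤ harmonic (2 * (n + 1)) := by exact_mod_cast harmonic_nonneg _
      calc errorBound (n + 1) 0 ≤ 2 / (2 * (n + 1)) * harmonic (2 * (n + 1)) :=
            mul_le_mul_of_nonneg_right hmatch hharm
        _ = 2 * (harmonic (2 * (n + 1)) / (2 * (n + 1) : ℕ)) := by
            push_cast
            ring

lemma tendsto_luckyPGF {z : ℂ} (hz : ‖z‖ ≤ 1) :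
    Tendsto (fun n => luckyPGF z n 0) atTop (nhds (limitPGF z 1)) := by
  obtain ⟨C, hC⟩ := exists_norm_luckyPGF_sub_limitPGF_le hz
  have hlim := tendsto_errorBound.const_mul C
  rw [mul_zero] at hlim
  refine tendsto_iff_norm_sub_tendsto_zero.2
    (squeeze_zero' (Eventually.of_forall fun _ => norm_nonneg _) ?_ hlim)
  filter_upwards [eventually_gt_atTop 0] with n hn
  simpa [unseenFraction, hn.ne'] using hC n 0

end Comparison

theorem theorem2p6 :
    TendstoInDistribution (fun (n : ℕ) (d : Deal n) => (d.luckyMoves : ℝ)) atTop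
      (fun k : ℕ => (k : ℝ)) uniformDeal (poissonMeasure (Real.toNNReal (Real.log 2))) := by
  refine ⟨fun n => measurable_from_top.aemeasurable, by fun_prop, ?_⟩
  refine ProbabilityMeasure.tendsto_iff_tendsto_charFun.2 fun t => ?_
  simp only [ProbabilityMeasure.coe_mk, charFun_luckyMoves]
  rw [charFun_map_cast_poissonMeasure, Real.coe_toNNReal _ (Real.log_nonneg one_le_two),
    ← limitPGF_one]
  exact tendsto_luckyPGF (Complex.norm_exp_ofReal_mul_I t).le
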